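/- For real $p\times p$ matrices $A,\Sigma_0\succ0,\Sigma_w\succ 0$ consider the Gauss–Markov source $x_{t+1}=Ax_t+w_t$, $x_0\sim N(0,\Sigma_0)$, with $w_t\sim N(0,\Sigma_w)$ white and independent of $x_0$. For $D>0$ put $$R_{0,n}(D)=\inf \tfrac1{n+1} I(x^n;y^n),\qquad x^n=(x_0,\dots,x_n),\ y^n=(y_0,\dots,y_n),$$ the infimum being over all causal reconstructions, i.e. all sequences of stochastic kernels $P(dy_t\mid y^{t-1},x^t)$, $t=0,\dots,n$, with values in $\mathbb R^p$, for which the joint law $P(dx^n)\otimes\prod_{t=0}^n P(dy_t\mid y^{t-1},x^t)$ satisfies $\mathbb E\|x_t-y_t\|^2\le D$ for $t=0,\dots,n$. Let $R^{\mathrm{SRD}}(D)=\lim_{n\to\infty}R_{0,n}(D)$ when the limit exists (logarithms are natural). Consider the claim that $$R^{\mathrm{SRD}}(D)=\tfrac12\log\det\!\big(AA^{\mathsf T}+\tfrac pD\Sigma_w\big)\quad\text{whenever}\quad \tfrac Dp\le\min_i\lambda_i\big(\tfrac Dp AA^{\mathsf T}+\Sigma_w\big).\tag{$*$}$$ **Counterexample.**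 Let $p=2$, $A=\mathrm{diag}(a,0)$ with $a^2>\tfrac23$, $\Sigma_w=I_2$, and let $\Sigma_0\succ0$ be arbitrary. Let $R_{0,n}$ denote the above function for this source, and let $R_{1;0,n}$, $R_{2;0,n}$ (with limits $R_1^{\mathrm{SRD}}$, $R_2^{\mathrm{SRD}}$) denote those of its two scalar components: $x_{1,t+1}=a x_{1,t}+w_{1,t}$ with initial variance $(\Sigma_0)_{11}$, and $x_{2,t+1}=w_{2,t}$ with initial variance $(\Sigma_0)_{22}$, both with unit noise variance. Then: 1. For $D>0$ the low-distortion condition in $(*)$ holds if and only if $D\le2$; in particular it holds at $D=1.5$. The right-hand side of $(*)$ equals $\tfrac12\log\big((a^2+\tfrac2D)\tfrac2D\big)$ for all $D>0$. 2. $R_{0,n}(D_1+D_2)\le R_{1;0,n}(D_1)+R_{2;0,n}(D_2)$ for all $n\ge 0$ and $D_1,D_2>0$. 3. At $D=1.5$ the right-hand side of $(*)$ is strictly larger than $\tfrac12\log(a^2+2)$. 4. Suppose that the scalar formula holds for the two components, that is, for all $D>0$ the limits exist and $R_1^{\mathrm{SRD}}(D)=\max\{0,\tfrac12\log(a^2+\tfrac1D)\}$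 and $R_2^{\mathrm{SRD}}(D)=\max\{0,\tfrac12\log\tfrac1D\}$. Then $R_1^{\mathrm{SRD}}(0.5)=\tfrac12\log(a^2+2)$, $R_2^{\mathrm{SRD}}(1)=0$, and $\limsup_{n}R_{0,n}(1.5)\le\tfrac12\log(a^2+2)$. Consequently the identity in $(*)$ is false at $D=1.5$, although $D=1.5$ lies in the low-distortion region. -/

import Mathlib

open MeasureTheory ProbabilityTheory Filter Topology
open scoped ENNReal

/-- State path `x^n = (x_0, …, x_n)` of the recursion `x_{t+1} = A x_t + w_t`. -/
noncomputable def statePath {p : ℕ} (A : Matrix (Fin p) (Fin p) ℝ) (n : ℕ)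
    (z : EuclideanSpace ℝ (Fin p) × (Fin n → EuclideanSpace ℝ (Fin p))) :
    Fin (n + 1) → EuclideanSpace ℝ (Fin p) :=
  Fin.induction z.1 (fun t x => Matrix.toEuclideanCLM (𝕜 := ℝ) A x + z.2 t)

theorem statePath_zero {p : ℕ} (A : Matrix (Fin p) (Fin p) ℝ) (n : ℕ)
    (z : EuclideanSpace ℝ (Fin p) × (Fin n → EuclideanSpace ℝ (Fin p))) :
    statePath A n z 0 = z.1 := rfl

theorem statePath_succ {p : ℕ} (A : Matrix (Fin p) (Fin p) ℝ) (n : ℕ)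
    (z : EuclideanSpace ℝ (Fin p) × (Fin n → EuclideanSpace ℝ (Fin p))) (t : Fin n) :
    statePath A n z t.succ =
      Matrix.toEuclideanCLM (𝕜 := ℝ) A (statePath A n z t.castSucc) + z.2 t := rfl

theorem measurable_statePath {p : ℕ} (A : Matrix (Fin p) (Fin p) ℝ) (n : ℕ) :
    Measurable (statePath A n) := by
  refine measurable_pi_lambda _ fun t => ?_
  induction t using Fin.induction with
  | zero => simpa only [statePath_zero] using measurable_fst
  | succ t ih =>
    simp only [statePath_succ]
    exact ((Matrix.toEuclideanCLM (𝕜 := ℝ) A).continuous.measurable.comp ih).add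
      ((measurable_pi_apply t).comp measurable_snd)

/-- Law of `x^n` for the Gauss-Markov process `x_{t+1} = A x_t + w_t`, with `x_0 ∼ N(0, S₀)` and
white noise `w_t ∼ N(0, Sw)` independent of `x_0`. -/
noncomputable def sourceLaw {p : ℕ} (A S₀ Sw : Matrix (Fin p) (Fin p) ℝ) (n : ℕ) :
    Measure (Fin (n + 1) → EuclideanSpace ℝ (Fin p)) :=
  ((multivariateGaussian 0 S₀).prod
    (Measure.pi fun _ : Fin n => multivariateGaussian 0 Sw)).map (statePath A n)

instance isProbabilityMeasure_sourceLaw {p : ℕ} (A S₀ Sw : Matrix (Fin p) (Fin p) ℝ) (n : ℕ) :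
    IsProbabilityMeasure (sourceLaw A S₀ Sw n) :=
  Measure.isProbabilityMeasure_map (measurable_statePath A n).aemeasurable

/-- A causal reconstruction policy: the stochastic kernels `P(dy_t | y^{t-1}, x^t)`, `t = 0, 1, …`.
Only the kernels with `t ≤ n` matter over the horizon `n`. -/
structure CausalPolicy (p : ℕ) where
  kernel : ∀ t : ℕ, Kernel
    ((Fin t → EuclideanSpace ℝ (Fin p)) × (Fin (t + 1) → EuclideanSpace ℝ (Fin p)))
    (EuclideanSpace ℝ (Fin p))
  markov : ∀ t, IsMarkovKernel (kernel t)

theorem measurable_finInit {E : Type*} [MeasurableSpace E] (n : ℕ) :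
    Measurable (fun x : Fin (n + 1) → E => (Fin.init x : Fin n → E)) :=
  measurable_pi_lambda _ fun i => measurable_pi_apply i.castSucc

theorem measurable_finSnoc {E : Type*} [MeasurableSpace E] (n : ℕ) :
    Measurable (fun z : (Fin n → E) × E => (Fin.snoc z.1 z.2 : Fin (n + 1) → E)) := by
  refine measurable_pi_lambda _ fun i => ?_
  refine Fin.lastCases ?_ (fun i => ?_) i
  · simpa only [Fin.snoc_last] using measurable_snd
  · simp only [Fin.snoc_castSucc]
    exact (measurable_pi_apply i).comp measurable_fst

/-- The causally conditioned law of the first `m` reconstructions given the first `m` source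
symbols, that is `∏_{t < m} P(dy_t | y^{t-1}, x^t)`. -/
noncomputable def CausalPolicy.causalKernel {p : ℕ} (κ : CausalPolicy p) :
    ∀ m : ℕ, Kernel (Fin m → EuclideanSpace ℝ (Fin p)) (Fin m → EuclideanSpace ℝ (Fin p))
  | 0 => Kernel.id
  | m + 1 =>
    (((κ.causalKernel m).comap (fun x => Fin.init x) (measurable_finInit m)) ⊗ₖ
      ((κ.kernel m).comap Prod.swap measurable_swap)).map (fun z => Fin.snoc z.1 z.2)

instance CausalPolicy.isMarkovKernel_causalKernel {p : ℕ} (κ : CausalPolicy p) (m : ℕ) :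
    IsMarkovKernel (κ.causalKernel m) := by
  induction m with
  | zero => unfold CausalPolicy.causalKernel; infer_instance
  | succ m ih =>
    have := κ.markov m
    unfold CausalPolicy.causalKernel
    exact Kernel.IsMarkovKernel.map _ (measurable_finSnoc m)

/-- Joint law `P(dx^n) ⊗ P(dy^n || x^n)` of source and reconstruction. -/
noncomputable def jointLaw {p : ℕ} (A S₀ Sw : Matrix (Fin p) (Fin p) ℝ) (κ : CausalPolicy p)
    (n : ℕ) : Measure
      ((Fin (n + 1) → EuclideanSpace ℝ (Fin p)) × (Fin (n + 1) → EuclideanSpace ℝ (Fin p))) :=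
  sourceLaw A S₀ Sw n ⊗ₘ κ.causalKernel (n + 1)

/-- Mutual information (in nats) of the two coordinates under a joint law. -/
noncomputable def mutualInfo {X Y : Type*} [MeasurableSpace X] [MeasurableSpace Y]
    (P : Measure (X × Y)) : ℝ≥0∞ :=
  InformationTheory.klDiv P (P.fst.prod P.snd)

/-- The per-letter distortion constraint `E ‖x_t - y_t‖² ≤ D` for `t = 0, …, n`. -/
def MeetsDistortion {p : ℕ} (A S₀ Sw : Matrix (Fin p) (Fin p) ℝ) (κ : CausalPolicy p)
    (n : ℕ) (D : ℝ) : Prop :=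
  ∀ t : Fin (n + 1), ∫⁻ z, ‖z.1 t - z.2 t‖ₑ ^ 2 ∂(jointLaw A S₀ Sw κ n) ≤ ENNReal.ofReal D

/-- The finite-time sequential rate-distortion function `R_{0,n}(D)` (in nats). -/
noncomputable def finiteSRD {p : ℕ} (A S₀ Sw : Matrix (Fin p) (Fin p) ℝ) (n : ℕ) (D : ℝ) : ℝ≥0∞ :=
  ⨅ (κ : CausalPolicy p) (_ : MeetsDistortion A S₀ Sw κ n D),
    mutualInfo (jointLaw A S₀ Sw κ n) / ((n : ℝ≥0∞) + 1)

/-- `R(D) = lim_n R_{0,n}(D)` exists and equals the real number `r`. -/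
def HasSRD {p : ℕ} (A S₀ Sw : Matrix (Fin p) (Fin p) ℝ) (D r : ℝ) : Prop :=
  Tendsto (fun n : ℕ => (finiteSRD A S₀ Sw n D : EReal)) atTop (𝓝 (r : EReal))

/-- The scalar formula `R(D) = max {0, ½ log (a² + σ_w / D)}`, `D > 0`, for the scalar source with
gain `a`, initial variance `s₀` and noise variance `sw`. -/
def ScalarFormula (a s₀ sw : ℝ) : Prop :=
  ∀ D : ℝ, 0 < D →
    HasSRD (p := 1) !![a] !![s₀] !![sw] D (max 0 (1 / 2 * Real.log (a ^ 2 + sw / D)))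

/-- The claimed closed form `½ log |A Aᵀ + (p / D) Σ_w|`. -/
noncomputable def claimedForm {p : ℕ} (A Sw : Matrix (Fin p) (Fin p) ℝ) (D : ℝ) : ℝ :=
  1 / 2 * Real.log (A * A.transpose + ((p : ℝ) / D) • Sw).det

/-- The claimed low-distortion region `D / p ≤ min_i λ_i ((D / p) A Aᵀ + Σ_w)`. -/
def LowDistortion {p : ℕ} (A Sw : Matrix (Fin p) (Fin p) ℝ) (D : ℝ) : Prop :=
  ∀ l ∈ spectrum ℝ ((D / (p : ℝ)) • (A * A.transpose) + Sw), D / (p : ℝ) ≤ l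

/-!
For `A = diag(a, 0)` the claimed value is the sum of the two scalar costs `½ log (a² + 1/d)` and
`½ log (1/d)` at the even split `d = D/2` of the distortion. The even split is not optimal: a unit of
distortion lowers the cost of the second, memoryless coordinate more than that of the first, whose
cost is damped by the memory term `a²`. At `D = 3/2` the split `1/2 + 1` makes the second coordinate
free and costs `½ log (a² + 2)` on the first; for `a² > 2/3` this is below the claimed value.

The substance is that coding the two coordinates separately is a causal policy whose information is
at most the sum of the two scalar ones (`finiteSRD_diagonal_le`), also when `S₀` correlates the
coordinates. Given the source, the separate reconstructions `y₁` and `y₂` are independent, and `yᵢ`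
depends on the source through its `i`-th coordinate only
(`CausalPolicy.lintegral_causalKernel_separate`). Replacing the law of `(y₁, y₂)` by the product of
its marginals can only increase the divergence that defines the mutual information
(`mutualInfo_le_klDiv_prod`). By the chain rule this larger divergence splits into one term for
`y₁` and one for `y₂`, and neither exceeds the corresponding scalar mutual information, because the
rest of the source can be resampled from the coordinate (`klDiv_compProd_comap_le`). Each coordinate
of the source has the scalar Gauss-Markov law (`map_coordPath_sourceLaw`), and squared errors of the
coordinates add up, which gives the distortion constraint (`MeetsDistortion.separate`).
-/

/-! ### Divergence and mutual information -/

section Information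

open InformationTheory

variable {X Y Z Ω : Type*} [MeasurableSpace X] [MeasurableSpace Y] [MeasurableSpace Z]
  [MeasurableSpace Ω]

theorem klDiv_map_measurableEquiv (e : X ≃ᵐ Y) (μ ν : Measure X) [IsFiniteMeasure μ]
    [IsFiniteMeasure ν] : klDiv (μ.map e) (ν.map e) = klDiv μ ν := by
  refine le_antisymm (klDiv_map_le μ ν e.measurable) ?_
  have h := klDiv_map_le (μ.map e) (ν.map e) e.symm.measurable
  simpa [Measure.map_map e.symm.measurable e.measurable] using h

/-- Among product measures with the right first marginal, the product of the marginals is closest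
to `P`: the excess divergence is `klDiv P.snd Q`, by the chain rule. -/
theorem mutualInfo_le_klDiv_prod [StandardBorelSpace X] [Nonempty X] (P : Measure (X × Y))
    [IsProbabilityMeasure P] (Q : Measure Y) [IsProbabilityMeasure Q] :
    mutualInfo P ≤ klDiv P (P.fst.prod Q) := by
  have key (ν : Measure Y) [IsProbabilityMeasure ν] : klDiv P (P.fst.prod ν) =
      klDiv ((P.map Prod.swap).fst ⊗ₘ (P.map Prod.swap).condKernel)
        (ν ⊗ₘ Kernel.const Y P.fst) := by
    rw [Measure.disintegrate, Measure.compProd_const, ← Measure.prod_swap (μ := P.fst)]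
    exact (klDiv_map_measurableEquiv MeasurableEquiv.prodComm P (P.fst.prod ν)).symm
  have hfst : (P.map Prod.swap).fst = P.snd := Measure.fst_map_swap
  -- Both divergences contain the same conditional term, and the other term vanishes for `P.snd`.
  rw [mutualInfo, key P.snd, key Q, hfst, klDiv_compProd_eq_add P.snd Q, ← hfst]
  exact le_add_self

theorem mutualInfo_map_right_le (P : Measure (X × Y)) [IsProbabilityMeasure P] {g : Y → Z}
    (hg : Measurable g) : mutualInfo (P.map (Prod.map id g)) ≤ mutualInfo P := by
  have hG : Measurable (Prod.map id g : X × Y → X × Z) := measurable_id.prodMap hg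
  have h : (P.map (Prod.map id g)).fst.prod (P.map (Prod.map id g)).snd =
      (P.fst.prod P.snd).map (Prod.map id g) := by
    rw [← Measure.map_prod_map _ _ measurable_id hg, Measure.fst, Measure.snd,
      Measure.map_map measurable_fst hG, Measure.map_map measurable_snd hG, Measure.fst,
      Measure.snd, Measure.map_id, Measure.map_map hg measurable_snd]
    rfl
  rw [mutualInfo, mutualInfo, h]
  exact klDiv_map_le _ _ hG

/-- Resampling `ω` from its conditional law given `f ω` turns the joint law of `(f ω, y)` into that
of `(ω, y)` when `y` depends on `ω` through `f ω` only. -/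
theorem condDistrib_comp_compProd_map [StandardBorelSpace Ω] [Nonempty Ω] (μ : Measure Ω)
    [IsProbabilityMeasure μ] {f : Ω → X} (hf : Measurable f) (K : Kernel X Y) [IsMarkovKernel K] :
    (((condDistrib id f μ).comap Prod.fst measurable_fst) ×ₖ
      (Kernel.deterministic (Prod.snd : X × Y → Y) measurable_snd)) ∘ₘ (μ.map f ⊗ₘ K) =
    μ ⊗ₘ K.comap f hf := by
  refine Measure.ext_of_lintegral _ fun g hg => ?_
  have hG : Measurable fun p : X × Ω => ∫⁻ y, g (p.2, y) ∂K p.1 := by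
    exact Measurable.lintegral_kernel_prod_right'
      (κ := K.comap (Prod.fst : X × Ω → X) measurable_fst)
      (f := fun q : (X × Ω) × Y => g (q.1.2, q.2)) (by fun_prop)
  rw [Measure.lintegral_bind (Kernel.aemeasurable _) hg.aemeasurable,
    Measure.lintegral_compProd (by fun_prop), Measure.lintegral_compProd hg]
  simp only [Kernel.lintegral_prod_deterministic _ _ _ hg, Kernel.comap_apply]
  have h := congrArg (fun m : Measure (X × Ω) => ∫⁻ p, ∫⁻ y, g (p.2, y) ∂K p.1 ∂m)
    (compProd_map_condDistrib (X := f) (Y := id) (μ := μ) aemeasurable_id)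
  simp only [id] at h
  rw [Measure.lintegral_compProd hG, lintegral_map hG (by fun_prop)] at h
  rw [← h]
  refine lintegral_congr fun x => ?_
  exact lintegral_lintegral_swap (f := fun y ω => g (ω, y)) (by fun_prop)

/-- If `y` depends on `ω` through `f ω` only, then the divergence of the law of `(ω, y)` from the
product `μ × Q` is at most that of the law of `(f ω, y)` from the product of its first marginal and
`Q`: data processing applied to the kernel that resamples `ω` from `f ω`. -/
theorem klDiv_compProd_comap_le [StandardBorelSpace Ω] [Nonempty Ω] (μ : Measure Ω)
    [IsProbabilityMeasure μ] {f : Ω → X} (hf : Measurable f) (K : Kernel X Y) [IsMarkovKernel K]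
    (Q : Measure Y) [IsProbabilityMeasure Q] :
    klDiv (μ ⊗ₘ K.comap f hf) (μ.prod Q) ≤ klDiv (μ.map f ⊗ₘ K) ((μ.map f).prod Q) := by
  have : IsProbabilityMeasure (μ.map f) := Measure.isProbabilityMeasure_map hf.aemeasurable
  have h := condDistrib_comp_compProd_map μ hf (Kernel.const X Q)
  rw [show (Kernel.const X Q).comap f hf = Kernel.const Ω Q from rfl, Measure.compProd_const,
    Measure.compProd_const] at h
  rw [← h, ← condDistrib_comp_compProd_map μ hf K]
  exact klDiv_comp_right_le _ _ _

/-- The law of `(ω, y₁, y₂)`, where `y₁` and `y₂` are drawn independently from kernels that see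
`f₁ ω` and `f₂ ω` respectively. -/
noncomputable def parallelLaw {X₁ X₂ Y₁ Y₂ : Type*} [MeasurableSpace X₁] [MeasurableSpace X₂]
    [MeasurableSpace Y₁] [MeasurableSpace Y₂] (μ : Measure Ω) {f₁ : Ω → X₁} {f₂ : Ω → X₂}
    (hf₁ : Measurable f₁) (hf₂ : Measurable f₂) (K₁ : Kernel X₁ Y₁) (K₂ : Kernel X₂ Y₂) :
    Measure (Ω × (Y₁ × Y₂)) :=
  μ ⊗ₘ (K₁.comap f₁ hf₁ ×ₖ K₂.comap f₂ hf₂)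

section Parallel

variable {X₁ X₂ Y₁ Y₂ : Type*} [MeasurableSpace X₁] [MeasurableSpace X₂]
  [MeasurableSpace Y₁] [MeasurableSpace Y₂] (μ : Measure Ω) [IsProbabilityMeasure μ]
  {f₁ : Ω → X₁} {f₂ : Ω → X₂} (hf₁ : Measurable f₁) (hf₂ : Measurable f₂)
  (K₁ : Kernel X₁ Y₁) [IsMarkovKernel K₁] (K₂ : Kernel X₂ Y₂) [IsMarkovKernel K₂]

theorem lintegral_parallelLaw {g : Ω × (Y₁ × Y₂) → ℝ≥0∞} (hg : Measurable g) :
    ∫⁻ z, g z ∂parallelLaw μ hf₁ hf₂ K₁ K₂ =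
      ∫⁻ ω, ∫⁻ y₁, ∫⁻ y₂, g (ω, y₁, y₂) ∂K₂ (f₂ ω) ∂K₁ (f₁ ω) ∂μ := by
  rw [parallelLaw, Measure.lintegral_compProd hg]
  refine lintegral_congr fun ω => ?_
  rw [Kernel.lintegral_prod _ _ _ (by fun_prop)]
  rfl

instance : IsProbabilityMeasure (parallelLaw μ hf₁ hf₂ K₁ K₂) := by
  unfold parallelLaw; infer_instance

theorem fst_parallelLaw : (parallelLaw μ hf₁ hf₂ K₁ K₂).fst = μ := by
  rw [parallelLaw, Measure.fst_compProd]

/-- Coding two functions of `ω` separately costs at most the sum of the two informations, whatever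
the dependence between `f₁ ω` and `f₂ ω`. -/
theorem mutualInfo_parallelLaw_le [StandardBorelSpace Ω] [StandardBorelSpace Y₁] [Nonempty Ω]
    [Nonempty Y₁] :
    mutualInfo (parallelLaw μ hf₁ hf₂ K₁ K₂) ≤
      mutualInfo (μ.map f₁ ⊗ₘ K₁) + mutualInfo (μ.map f₂ ⊗ₘ K₂) := by
  have : IsProbabilityMeasure (μ.map f₁) := Measure.isProbabilityMeasure_map hf₁.aemeasurable
  have : IsProbabilityMeasure (μ.map f₂) := Measure.isProbabilityMeasure_map hf₂.aemeasurable
  set Q₁ := (μ.map f₁ ⊗ₘ K₁).snd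
  set Q₂ := (μ.map f₂ ⊗ₘ K₂).snd
  set M := μ ⊗ₘ K₁.comap f₁ hf₁ with hM
  have hP : (parallelLaw μ hf₁ hf₂ K₁ K₂).map MeasurableEquiv.prodAssoc.symm =
      M ⊗ₘ K₂.comap (f₂ ∘ Prod.fst) (hf₂.comp measurable_fst) := by
    refine Measure.ext_of_lintegral _ fun g hg => ?_
    have hG : Measurable fun p : Ω × Y₁ => ∫⁻ y, g (p, y) ∂K₂ ((f₂ ∘ Prod.fst) p) :=
      Measurable.lintegral_kernel_prod_right'
        (κ := K₂.comap (f₂ ∘ Prod.fst) (hf₂.comp measurable_fst)) hg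
    rw [lintegral_map hg (MeasurableEquiv.measurable _), Measure.lintegral_compProd hg]
    simp only [Kernel.comap_apply]
    rw [hM, Measure.lintegral_compProd hG]
    exact lintegral_parallelLaw μ hf₁ hf₂ K₁ K₂ (hg.comp (MeasurableEquiv.measurable _))
  have hprod : (μ.prod (Q₁.prod Q₂)).map MeasurableEquiv.prodAssoc.symm =
      (μ.prod Q₁) ⊗ₘ Kernel.const (Ω × Y₁) Q₂ := by
    rw [Measure.compProd_const, ← Measure.prodAssoc_prod,
      Measure.map_map (MeasurableEquiv.measurable _) (MeasurableEquiv.measurable _)]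
    simp
  have hMf : M.map (f₂ ∘ Prod.fst) = μ.map f₂ := by
    rw [← Measure.map_map hf₂ measurable_fst]
    exact congrArg (Measure.map f₂) (Measure.fst_compProd μ _)
  calc mutualInfo (parallelLaw μ hf₁ hf₂ K₁ K₂)
      ≤ klDiv (parallelLaw μ hf₁ hf₂ K₁ K₂) (μ.prod (Q₁.prod Q₂)) := by
        have h := mutualInfo_le_klDiv_prod (parallelLaw μ hf₁ hf₂ K₁ K₂) (Q₁.prod Q₂)
        rwa [fst_parallelLaw] at h
    _ = klDiv M (μ.prod Q₁) +
          klDiv (M ⊗ₘ K₂.comap (f₂ ∘ Prod.fst) (hf₂.comp measurable_fst))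
            (M.prod Q₂) := by
        rw [← klDiv_map_measurableEquiv MeasurableEquiv.prodAssoc.symm, hP, hprod,
          klDiv_compProd_eq_add, Measure.compProd_const]
    _ ≤ klDiv (μ.map f₁ ⊗ₘ K₁) ((μ.map f₁).prod Q₁) +
          klDiv (μ.map f₂ ⊗ₘ K₂) ((μ.map f₂).prod Q₂) := by
        refine add_le_add (klDiv_compProd_comap_le μ hf₁ K₁ Q₁) ?_
        have h := klDiv_compProd_comap_le M (hf₂.comp measurable_fst) K₂ Q₂
        rwa [hMf] at h
    _ = mutualInfo (μ.map f₁ ⊗ₘ K₁) + mutualInfo (μ.map f₂ ⊗ₘ K₂) := by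
        rw [mutualInfo, mutualInfo, Measure.fst_compProd, Measure.fst_compProd]

end Parallel

end Information

/-! ### Coordinates of paths in the plane -/

section Coordinates

/-- The coordinate `x i` of a point of the plane, as a point of the one-dimensional space. -/
noncomputable def coord (i : Fin 2) : EuclideanSpace ℝ (Fin 2) →L[ℝ] EuclideanSpace ℝ (Fin 1) :=
  ((PiLp.continuousLinearEquiv 2 ℝ fun _ : Fin 1 => ℝ).symm : (Fin 1 → ℝ) →L[ℝ] _) ∘L
    ContinuousLinearMap.pi fun _ => EuclideanSpace.proj i

@[simp]
theorem coord_apply (i : Fin 2) (x : EuclideanSpace ℝ (Fin 2)) (j : Fin 1) :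
    coord i x j = x i := rfl

/-- The point of the plane with given coordinates. -/
noncomputable def mergeCoord (z : EuclideanSpace ℝ (Fin 1) × EuclideanSpace ℝ (Fin 1)) :
    EuclideanSpace ℝ (Fin 2) :=
  !₂[z.1 0, z.2 0]

@[fun_prop]
theorem measurable_mergeCoord : Measurable mergeCoord := by
  unfold mergeCoord
  refine (PiLp.continuous_toLp 2 _).measurable.comp (measurable_pi_lambda _ fun i => ?_)
  fin_cases i <;> simp <;> fun_prop

@[simp]
theorem coord_zero_mergeCoord (z : EuclideanSpace ℝ (Fin 1) × EuclideanSpace ℝ (Fin 1)) :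
    coord 0 (mergeCoord z) = z.1 := by
  ext j
  simp [mergeCoord, Subsingleton.elim j 0]

@[simp]
theorem coord_one_mergeCoord (z : EuclideanSpace ℝ (Fin 1) × EuclideanSpace ℝ (Fin 1)) :
    coord 1 (mergeCoord z) = z.2 := by
  ext j
  simp [mergeCoord, Subsingleton.elim j 0]

@[simp]
theorem mergeCoord_coord (x : EuclideanSpace ℝ (Fin 2)) :
    mergeCoord (coord 0 x, coord 1 x) = x := by
  ext i
  fin_cases i <;> simp [mergeCoord]

theorem enorm_sq_eq_coord (x : EuclideanSpace ℝ (Fin 2)) :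
    ‖x‖ₑ ^ 2 = ‖coord 0 x‖ₑ ^ 2 + ‖coord 1 x‖ₑ ^ 2 := by
  have h (k : ℕ) (y : EuclideanSpace ℝ (Fin k)) : ‖y‖ₑ ^ 2 = ENNReal.ofReal (‖y‖ ^ 2) := by
    rw [ENNReal.ofReal_pow (norm_nonneg y), ofReal_norm]
  rw [h, h, h, ← ENNReal.ofReal_add (by positivity) (by positivity)]
  simp [EuclideanSpace.real_norm_sq_eq]

variable {m : ℕ}

/-- The path of the `i`-th coordinate of a path in the plane. -/
noncomputable def coordPath (i : Fin 2) (x : Fin m → EuclideanSpace ℝ (Fin 2)) :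
    Fin m → EuclideanSpace ℝ (Fin 1) :=
  fun t => coord i (x t)

/-- The path in the plane with given coordinate paths. -/
noncomputable def mergePath
    (z : (Fin m → EuclideanSpace ℝ (Fin 1)) × (Fin m → EuclideanSpace ℝ (Fin 1))) :
    Fin m → EuclideanSpace ℝ (Fin 2) :=
  fun t => mergeCoord (z.1 t, z.2 t)

@[fun_prop]
theorem measurable_coordPath (i : Fin 2) :
    Measurable (coordPath i : (Fin m → EuclideanSpace ℝ (Fin 2)) → _) := by
  unfold coordPath; fun_prop

@[fun_prop]
theorem measurable_mergePath : Measurable (mergePath (m := m)) := by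
  unfold mergePath; fun_prop

@[simp]
theorem coordPath_zero_mergePath
    (z : (Fin m → EuclideanSpace ℝ (Fin 1)) × (Fin m → EuclideanSpace ℝ (Fin 1))) :
    coordPath 0 (mergePath z) = z.1 := by
  ext1 t; simp [coordPath, mergePath]

@[simp]
theorem coordPath_one_mergePath
    (z : (Fin m → EuclideanSpace ℝ (Fin 1)) × (Fin m → EuclideanSpace ℝ (Fin 1))) :
    coordPath 1 (mergePath z) = z.2 := by
  ext1 t; simp [coordPath, mergePath]

@[simp]
theorem mergePath_coordPath (x : Fin m → EuclideanSpace ℝ (Fin 2)) :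
    mergePath (coordPath 0 x, coordPath 1 x) = x := by
  ext1 t; simp [coordPath, mergePath]

theorem mergePath_snoc (y₁ y₂ : Fin m → EuclideanSpace ℝ (Fin 1))
    (u₁ u₂ : EuclideanSpace ℝ (Fin 1)) :
    mergePath (Fin.snoc y₁ u₁, Fin.snoc y₂ u₂) =
      (Fin.snoc (mergePath (y₁, y₂)) (mergeCoord (u₁, u₂)) : Fin (m + 1) → _) := by
  ext1 t
  refine Fin.lastCases ?_ (fun t => ?_) t <;> simp [mergePath]

end Coordinates

/-! ### Separate coding of the two coordinates -/

namespace CausalPolicy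

variable (κ₁ κ₂ : CausalPolicy 1)

/-- The policy in the plane that codes the first coordinate with `κ₁` and, independently, the second
one with `κ₂`. -/
noncomputable def separate : CausalPolicy 2 where
  kernel t :=
    ((κ₁.kernel t).comap (Prod.map (coordPath 0) (coordPath 0)) (by fun_prop) ×ₖ
      (κ₂.kernel t).comap (Prod.map (coordPath 1) (coordPath 1)) (by fun_prop)).map mergeCoord
  markov t := by
    have := κ₁.markov t
    have := κ₂.markov t
    exact Kernel.IsMarkovKernel.map _ measurable_mergeCoord

theorem lintegral_kernel_separate (t : ℕ)
    (z : (Fin t → EuclideanSpace ℝ (Fin 2)) × (Fin (t + 1) → EuclideanSpace ℝ (Fin 2)))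
    {g : EuclideanSpace ℝ (Fin 2) → ℝ≥0∞} (hg : Measurable g) :
    ∫⁻ u, g u ∂(separate κ₁ κ₂).kernel t z =
      ∫⁻ u₁, ∫⁻ u₂, g (mergeCoord (u₁, u₂)) ∂κ₂.kernel t (coordPath 1 z.1, coordPath 1 z.2)
        ∂κ₁.kernel t (coordPath 0 z.1, coordPath 0 z.2) := by
  have := κ₁.markov t
  have := κ₂.markov t
  rw [separate, Kernel.lintegral_map _ measurable_mergeCoord _ hg]
  exact Kernel.lintegral_prod _ _ _ (hg.comp measurable_mergeCoord)

theorem lintegral_causalKernel_succ {p : ℕ} (κ : CausalPolicy p) (m : ℕ)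
    (x : Fin (m + 1) → EuclideanSpace ℝ (Fin p))
    {g : (Fin (m + 1) → EuclideanSpace ℝ (Fin p)) → ℝ≥0∞} (hg : Measurable g) :
    ∫⁻ y, g y ∂κ.causalKernel (m + 1) x =
      ∫⁻ y, ∫⁻ u, g (Fin.snoc y u) ∂κ.kernel m (y, x) ∂κ.causalKernel m (Fin.init x) := by
  have := κ.markov m
  rw [causalKernel, Kernel.lintegral_map _ (measurable_finSnoc m) _ hg]
  exact Kernel.lintegral_compProd _ _ _ (hg.comp (measurable_finSnoc m))

/-- Under separate coding the reconstructions of the two coordinates are conditionally independent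
given the source, each following its own causal kernel. -/
theorem lintegral_causalKernel_separate (m : ℕ) (x : Fin m → EuclideanSpace ℝ (Fin 2))
    {g : (Fin m → EuclideanSpace ℝ (Fin 2)) → ℝ≥0∞} (hg : Measurable g) :
    ∫⁻ y, g y ∂(separate κ₁ κ₂).causalKernel m x =
      ∫⁻ y₁, ∫⁻ y₂, g (mergePath (y₁, y₂)) ∂κ₂.causalKernel m (coordPath 1 x)
        ∂κ₁.causalKernel m (coordPath 0 x) := by
  induction m with
  | zero =>
    have h1 : Measurable fun y₂ => g (mergePath (coordPath 0 x, y₂)) := by fun_prop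
    simp only [causalKernel, Kernel.id_apply]
    rw [lintegral_dirac' _ hg, lintegral_dirac' _ (by fun_prop), lintegral_dirac' _ h1,
      mergePath_coordPath]
  | succ m ih =>
    have := κ₁.markov m
    have := κ₂.markov m
    have := (separate κ₁ κ₂).markov m
    have hs (k : ℕ) : Measurable fun z : (Fin m → EuclideanSpace ℝ (Fin k)) ×
        EuclideanSpace ℝ (Fin k) => (Fin.snoc z.1 z.2 : Fin (m + 1) → _) := measurable_finSnoc m
    have hG : Measurable fun y => ∫⁻ u, g (Fin.snoc y u) ∂(separate κ₁ κ₂).kernel m (y, x) :=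
      Measurable.lintegral_kernel_prod_right'
        (κ := ((separate κ₁ κ₂).kernel m).comap (fun y => (y, x)) (by fun_prop))
        (f := fun z => g (Fin.snoc z.1 z.2)) (hg.comp (hs 2))
    have hsec (y : Fin m → EuclideanSpace ℝ (Fin 2)) : Measurable fun u => g (Fin.snoc y u) :=
      (hg.comp (hs 2)).comp (measurable_const.prodMk measurable_id)
    rw [lintegral_causalKernel_succ _ _ _ hg, ih _ hG]
    rw [lintegral_causalKernel_succ κ₁ m (coordPath 0 x)
      (Measurable.lintegral_prod_right' (f := fun z => g (mergePath z)) (by fun_prop))]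
    refine lintegral_congr fun y₁ => ?_
    simp only [lintegral_kernel_separate κ₁ κ₂ m _ (hsec _), coordPath_zero_mergePath,
      coordPath_one_mergePath]
    -- The first coordinate's new symbol `u₁` was drawn after the second coordinate's past `y₂`.
    rw [lintegral_lintegral_swap]
    · refine lintegral_congr fun u₁ => ?_
      rw [lintegral_causalKernel_succ κ₂ m (coordPath 1 x) (by fun_prop)]
      simp only [mergePath_snoc]
      rfl
    · refine Measurable.aemeasurable ?_
      refine Measurable.lintegral_kernel_prod_right'
        (κ := (κ₂.kernel m).comap (fun q : (Fin m → EuclideanSpace ℝ (Fin 1)) ×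
          EuclideanSpace ℝ (Fin 1) => (q.1, coordPath 1 x)) (by fun_prop))
        (f := fun r => g (Fin.snoc (mergePath (y₁, r.1.1)) (mergeCoord (r.1.2, r.2)))) ?_
      exact hg.comp ((hs 2).comp (f := fun r : ((Fin m → EuclideanSpace ℝ (Fin 1)) ×
        EuclideanSpace ℝ (Fin 1)) × EuclideanSpace ℝ (Fin 1) =>
          (mergePath (y₁, r.1.1), mergeCoord (r.1.2, r.2))) (by fun_prop))

end CausalPolicy

/-! ### Coordinates of the source -/

theorem map_coord_multivariateGaussian {S : Matrix (Fin 2) (Fin 2) ℝ} (hS : S.PosSemidef)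
    (i : Fin 2) :
    (multivariateGaussian 0 S).map (coord i) = multivariateGaussian 0 !![S i i] := by
  have hS' : (!![S i i] : Matrix (Fin 1) (Fin 1) ℝ).PosSemidef := by
    convert! hS.submatrix (fun _ : Fin 1 => i) using 1
    ext j k
    simp [Subsingleton.elim j 0, Subsingleton.elim k 0]
  refine Measure.ext_of_charFun (funext fun t => ?_)
  have hinner (x : EuclideanSpace ℝ (Fin 2)) :
      inner ℝ (coord i x) t = inner ℝ x (EuclideanSpace.single i (t 0)) := by
    simp [PiLp.inner_apply]
  rw [charFun_apply, integral_map (by fun_prop) (by fun_prop)]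
  simp only [hinner]
  rw [← charFun_apply, charFun_multivariateGaussian hS, charFun_multivariateGaussian hS']
  simp [Matrix.mulVec, dotProduct, PiLp.single_apply]

theorem coord_toEuclideanCLM_diag (d : Fin 2 → ℝ) (i : Fin 2) (x : EuclideanSpace ℝ (Fin 2)) :
    coord i (Matrix.toEuclideanCLM (𝕜 := ℝ) (Matrix.diagonal d) x) =
      Matrix.toEuclideanCLM (𝕜 := ℝ) !![d i] (coord i x) := by
  ext j
  rw [coord_apply, Matrix.ofLp_toEuclideanCLM, Matrix.mulVec_diagonal, Matrix.ofLp_toEuclideanCLM]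
  simp [Matrix.mulVec, dotProduct]

theorem coordPath_statePath (d : Fin 2 → ℝ) (i : Fin 2) (n : ℕ)
    (z : EuclideanSpace ℝ (Fin 2) × (Fin n → EuclideanSpace ℝ (Fin 2))) :
    coordPath i (statePath (Matrix.diagonal d) n z) =
      statePath !![d i] n (coord i z.1, coordPath i z.2) := by
  ext1 t
  induction t using Fin.induction with
  | zero => rfl
  | succ t ih =>
    rw [coordPath] at ih ⊢
    rw [statePath_succ, statePath_succ, map_add, coord_toEuclideanCLM_diag, ih]
    rfl

/-- Each coordinate of a diagonal Gauss-Markov source is a scalar Gauss-Markov source, also when the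
coordinates are correlated. -/
theorem map_coordPath_sourceLaw (d : Fin 2 → ℝ) {S₀ Sw : Matrix (Fin 2) (Fin 2) ℝ}
    (hS₀ : S₀.PosSemidef) (hSw : Sw.PosSemidef) (n : ℕ) (i : Fin 2) :
    (sourceLaw (Matrix.diagonal d) S₀ Sw n).map (coordPath i) =
      sourceLaw !![d i] !![S₀ i i] !![Sw i i] n := by
  have hnoise : (Measure.pi fun _ : Fin n => multivariateGaussian 0 Sw).map (coordPath i) =
      Measure.pi fun _ : Fin n => multivariateGaussian 0 !![Sw i i] := by
    rw [← map_coord_multivariateGaussian hSw i]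
    exact (Measure.pi_map_pi fun _ => (coord i).measurable.aemeasurable)
  rw [sourceLaw, Measure.map_map (measurable_coordPath i) (measurable_statePath _ n), sourceLaw,
    ← map_coord_multivariateGaussian hS₀ i, ← hnoise,
    Measure.map_prod_map _ _ (coord i).measurable (measurable_coordPath i),
    Measure.map_map (measurable_statePath _ n)
      ((coord i).measurable.prodMap (measurable_coordPath i))]
  congr 1
  ext1 z
  exact coordPath_statePath d i n z

/-! ### Subadditivity of the rate-distortion function -/

section Separate

variable (d : Fin 2 → ℝ) {S₀ Sw : Matrix (Fin 2) (Fin 2) ℝ} (κ₁ κ₂ : CausalPolicy 1) (n : ℕ)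

theorem lintegral_jointLaw_separate (A S₀ Sw : Matrix (Fin 2) (Fin 2) ℝ)
    {g : (Fin (n + 1) → EuclideanSpace ℝ (Fin 2)) × (Fin (n + 1) → EuclideanSpace ℝ (Fin 2)) →
      ℝ≥0∞} (hg : Measurable g) :
    ∫⁻ z, g z ∂jointLaw A S₀ Sw (κ₁.separate κ₂) n =
      ∫⁻ x, ∫⁻ y₁, ∫⁻ y₂, g (x, mergePath (y₁, y₂)) ∂κ₂.causalKernel (n + 1) (coordPath 1 x)
        ∂κ₁.causalKernel (n + 1) (coordPath 0 x) ∂sourceLaw A S₀ Sw n := by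
  rw [jointLaw, Measure.lintegral_compProd hg]
  refine lintegral_congr fun x => ?_
  exact CausalPolicy.lintegral_causalKernel_separate κ₁ κ₂ (n + 1) x
    (hg.comp measurable_prodMk_left)

theorem jointLaw_separate (A S₀ Sw : Matrix (Fin 2) (Fin 2) ℝ) :
    jointLaw A S₀ Sw (κ₁.separate κ₂) n =
      (parallelLaw (sourceLaw A S₀ Sw n) (measurable_coordPath 0) (measurable_coordPath 1)
        (κ₁.causalKernel (n + 1)) (κ₂.causalKernel (n + 1))).map (Prod.map id mergePath) := by
  have hm : Measurable (Prod.map (id : (Fin (n + 1) → EuclideanSpace ℝ (Fin 2)) → _)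
      (mergePath (m := n + 1))) := measurable_id.prodMap measurable_mergePath
  refine Measure.ext_of_lintegral _ fun g hg => ?_
  rw [lintegral_map hg hm, lintegral_jointLaw_separate κ₁ κ₂ n A S₀ Sw hg]
  exact (lintegral_parallelLaw _ _ _ _ _ (hg.comp hm)).symm

theorem mutualInfo_jointLaw_separate_le (hS₀ : S₀.PosSemidef) (hSw : Sw.PosSemidef) :
    mutualInfo (jointLaw (Matrix.diagonal d) S₀ Sw (κ₁.separate κ₂) n) ≤
      mutualInfo (jointLaw !![d 0] !![S₀ 0 0] !![Sw 0 0] κ₁ n) +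
        mutualInfo (jointLaw !![d 1] !![S₀ 1 1] !![Sw 1 1] κ₂ n) := by
  rw [jointLaw_separate, jointLaw, jointLaw, ← map_coordPath_sourceLaw d hS₀ hSw n 0,
    ← map_coordPath_sourceLaw d hS₀ hSw n 1]
  exact (mutualInfo_map_right_le _ measurable_mergePath).trans (mutualInfo_parallelLaw_le _ _ _ _ _)

theorem MeetsDistortion.separate (hS₀ : S₀.PosSemidef) (hSw : Sw.PosSemidef)
    {D₁ D₂ : ℝ} (hD₁ : 0 ≤ D₁) (hD₂ : 0 ≤ D₂)
    (h₁ : MeetsDistortion !![d 0] !![S₀ 0 0] !![Sw 0 0] κ₁ n D₁)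
    (h₂ : MeetsDistortion !![d 1] !![S₀ 1 1] !![Sw 1 1] κ₂ n D₂) :
    MeetsDistortion (Matrix.diagonal d) S₀ Sw (κ₁.separate κ₂) n (D₁ + D₂) := by
  intro t
  have hcost (k : ℕ) : Measurable fun z : (Fin (n + 1) → EuclideanSpace ℝ (Fin k)) ×
      (Fin (n + 1) → EuclideanSpace ℝ (Fin k)) => ‖z.1 t - z.2 t‖ₑ ^ 2 := by fun_prop
  specialize h₁ t
  specialize h₂ t
  rw [jointLaw, Measure.lintegral_compProd (hcost 1), ← map_coordPath_sourceLaw d hS₀ hSw n,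
    lintegral_map (hcost 1).lintegral_kernel_prod_right' (measurable_coordPath _)] at h₁ h₂
  rw [lintegral_jointLaw_separate κ₁ κ₂ n _ S₀ Sw (hcost 2), ENNReal.ofReal_add hD₁ hD₂]
  refine le_trans (le_of_eq ?_) (add_le_add h₁ h₂)
  have hmeas : Measurable fun x : Fin (n + 1) → EuclideanSpace ℝ (Fin 2) =>
      ∫⁻ y, ‖coordPath 0 x t - y t‖ₑ ^ 2 ∂κ₁.causalKernel (n + 1) (coordPath 0 x) :=
    (hcost 1).lintegral_kernel_prod_right'.comp (measurable_coordPath 0)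
  refine Eq.trans (lintegral_congr fun x => ?_) (lintegral_add_left hmeas _)
  have hsplit (y₁ y₂ : Fin (n + 1) → EuclideanSpace ℝ (Fin 1)) :
      ‖x t - mergePath (y₁, y₂) t‖ₑ ^ 2 =
        ‖coordPath 0 x t - y₁ t‖ₑ ^ 2 + ‖coordPath 1 x t - y₂ t‖ₑ ^ 2 := by
    rw [enorm_sq_eq_coord, map_sub, map_sub]
    simp [mergePath, coordPath]
  simp only [hsplit]
  have hsec (w : Fin (n + 1) → EuclideanSpace ℝ (Fin 1)) :
      Measurable fun y : Fin (n + 1) → EuclideanSpace ℝ (Fin 1) => ‖w t - y t‖ₑ ^ 2 := by fun_prop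
  simp [lintegral_add_left, hsec, lintegral_const]

/-- The infimum on the left runs over more policies than the separate ones, which already achieve
the sum on the right. -/
theorem finiteSRD_diagonal_le (hS₀ : S₀.PosSemidef) (hSw : Sw.PosSemidef)
    {D₁ D₂ : ℝ} (hD₁ : 0 ≤ D₁) (hD₂ : 0 ≤ D₂) :
    finiteSRD (Matrix.diagonal d) S₀ Sw n (D₁ + D₂) ≤
      finiteSRD !![d 0] !![S₀ 0 0] !![Sw 0 0] n D₁ +
        finiteSRD !![d 1] !![S₀ 1 1] !![Sw 1 1] n D₂ := by
  simp only [finiteSRD]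
  refine ENNReal.le_iInf₂_add_iInf₂ fun κ₁ h₁ κ₂ h₂ => ?_
  refine (iInf₂_le (κ₁.separate κ₂) (h₁.separate d κ₁ κ₂ n hS₀ hSw hD₁ hD₂ h₂)).trans ?_
  rw [← ENNReal.add_div]
  gcongr
  exact mutualInfo_jointLaw_separate_le d κ₁ κ₂ n hS₀ hSw

end Separate

/-! ### Closed form, low-distortion region and limits -/

theorem diag_mul_transpose (a : ℝ) :
    !![a, 0; 0, 0] * (!![a, 0; 0, 0] : Matrix (Fin 2) (Fin 2) ℝ).transpose =
      Matrix.diagonal ![a ^ 2, 0] := by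
  ext i j
  rw [Matrix.mul_apply, Fin.sum_univ_two]
  fin_cases i <;> fin_cases j <;> simp [pow_two]

theorem lowDistortion_diag_iff (a : ℝ) {D : ℝ} (hD : 0 < D) :
    LowDistortion !![a, 0; 0, 0] 1 D ↔ D ≤ 2 := by
  have hM : (D / ((2 : ℕ) : ℝ)) •
      (!![a, 0; 0, 0] * (!![a, 0; 0, 0] : Matrix (Fin 2) (Fin 2) ℝ).transpose) + 1 =
        Matrix.diagonal ![D / 2 * a ^ 2 + 1, 1] := by
    rw [diag_mul_transpose]
    ext i j
    fin_cases i <;> fin_cases j <;> simp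
  rw [LowDistortion, hM, spectrum_diagonal, Set.forall_mem_range, Fin.forall_fin_two]
  simp only [Matrix.cons_val_zero, Matrix.cons_val_one]
  push_cast
  constructor
  · rintro ⟨-, h⟩
    linarith
  · intro h
    have : 0 ≤ D / 2 * a ^ 2 := by positivity
    exact ⟨by linarith, by linarith⟩

theorem claimedForm_diag (a : ℝ) (D : ℝ) :
    claimedForm !![a, 0; 0, 0] 1 D = 1 / 2 * Real.log ((a ^ 2 + 2 / D) * (2 / D)) := by
  rw [claimedForm, diag_mul_transpose, Matrix.det_fin_two]
  simp

theorem log_lt_claimedForm_diag {a : ℝ} (ha : 2 / 3 < a ^ 2) :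
    1 / 2 * Real.log (a ^ 2 + 2) < claimedForm !![a, 0; 0, 0] 1 (3 / 2) := by
  rw [claimedForm_diag]
  have h : a ^ 2 + 2 < (a ^ 2 + 2 / (3 / 2)) * (2 / (3 / 2)) := by linarith
  have := Real.log_lt_log (by positivity) h
  linarith

/-- Since both limits are real, their sum avoids the points where addition on `EReal` is not
continuous. -/
theorem limsup_le_of_le_add {u v w : ℕ → ℝ≥0∞} {r s : ℝ} (h : ∀ n, w n ≤ u n + v n)
    (hu : Tendsto (fun n => (u n : EReal)) atTop (𝓝 (r : EReal)))
    (hv : Tendsto (fun n => (v n : EReal)) atTop (𝓝 (s : EReal))) :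
    limsup (fun n => (w n : EReal)) atTop ≤ ((r + s : ℝ) : EReal) := by
  have hsum : Tendsto (fun n => (u n : EReal) + v n) atTop (𝓝 ((r + s : ℝ) : EReal)) := by
    rw [EReal.coe_add]
    exact (EReal.continuousAt_add (p := ((r : EReal), (s : EReal))) (by simp) (by simp)).tendsto.comp
      (hu.prodMk_nhds hv)
  rw [← hsum.limsup_eq]
  refine limsup_le_limsup (Eventually.of_forall fun n => ?_)
  have := EReal.coe_ennreal_le_coe_ennreal_iff.2 (h n)
  rwa [EReal.coe_ennreal_add] at this

/-! ### The counterexample -/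

theorem mainTheorem2 (a : ℝ) (ha : 2 / 3 < a ^ 2) (S₀ : Matrix (Fin 2) (Fin 2) ℝ)
    (hS₀ : S₀.PosDef) :
    -- the low-distortion region and the claimed closed form for this source
    (∀ D : ℝ, 0 < D → (LowDistortion !![a, 0; 0, 0] 1 D ↔ D ≤ 2)) ∧
    (∀ D : ℝ, 0 < D →
      claimedForm !![a, 0; 0, 0] 1 D = 1 / 2 * Real.log ((a ^ 2 + 2 / D) * (2 / D))) ∧
    -- coding the two scalar components separately is achievable
    (∀ (n : ℕ) (D₁ D₂ : ℝ), 0 < D₁ → 0 < D₂ →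
      finiteSRD !![a, 0; 0, 0] S₀ 1 n (D₁ + D₂) ≤
        finiteSRD (p := 1) !![a] !![S₀ 0 0] !![1] n D₁ +
          finiteSRD (p := 1) !![0] !![S₀ 1 1] !![1] n D₂) ∧
    -- at `D = 3/2`, inside the region, the claimed closed form exceeds the upper bound
    LowDistortion !![a, 0; 0, 0] 1 (3 / 2) ∧
    1 / 2 * Real.log (a ^ 2 + 2) < claimedForm !![a, 0; 0, 0] 1 (3 / 2) ∧
    -- if the scalar formula holds for the two components, the claimed closed form is false
    (ScalarFormula a (S₀ 0 0) 1 → ScalarFormula 0 (S₀ 1 1) 1 →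
      HasSRD (p := 1) !![a] !![S₀ 0 0] !![1] (1 / 2) (1 / 2 * Real.log (a ^ 2 + 2)) ∧
      HasSRD (p := 1) !![0] !![S₀ 1 1] !![1] 1 0 ∧
      limsup (fun n : ℕ => (finiteSRD !![a, 0; 0, 0] S₀ 1 n (3 / 2) : EReal)) atTop ≤
        ((1 / 2 * Real.log (a ^ 2 + 2) : ℝ) : EReal) ∧
      ¬ HasSRD !![a, 0; 0, 0] S₀ 1 (3 / 2) (claimedForm !![a, 0; 0, 0] 1 (3 / 2))) := by
  have hsub : ∀ (n : ℕ) (D₁ D₂ : ℝ), 0 < D₁ → 0 < D₂ →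
      finiteSRD !![a, 0; 0, 0] S₀ 1 n (D₁ + D₂) ≤
        finiteSRD (p := 1) !![a] !![S₀ 0 0] !![1] n D₁ +
          finiteSRD (p := 1) !![0] !![S₀ 1 1] !![1] n D₂ := by
    intro n D₁ D₂ hD₁ hD₂
    have hA : (!![a, 0; 0, 0] : Matrix (Fin 2) (Fin 2) ℝ) = Matrix.diagonal ![a, 0] := by
      ext i j
      fin_cases i <;> fin_cases j <;> simp
    rw [hA]
    exact finiteSRD_diagonal_le ![a, 0] n hS₀.posSemidef Matrix.PosSemidef.one hD₁.le hD₂.le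
  refine ⟨fun D hD => lowDistortion_diag_iff a hD, fun D _ => claimedForm_diag a D, hsub,
    (lowDistortion_diag_iff a (by norm_num)).2 (by norm_num), log_lt_claimedForm_diag ha,
    fun h₁ h₂ => ?_⟩
  have hlog : 0 ≤ Real.log (a ^ 2 + 2) := Real.log_nonneg (by linarith)
  have hR₁ : HasSRD (p := 1) !![a] !![S₀ 0 0] !![1] (1 / 2) (1 / 2 * Real.log (a ^ 2 + 2)) := by
    have h := h₁ (1 / 2) (by norm_num)
    rwa [show (1 : ℝ) / (1 / 2) = 2 by norm_num, max_eq_right (by positivity)] at h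
  have hR₂ : HasSRD (p := 1) !![0] !![S₀ 1 1] !![1] 1 0 := by
    have h := h₂ 1 one_pos
    norm_num at h
    exact h
  have hlim : limsup (fun n : ℕ => (finiteSRD !![a, 0; 0, 0] S₀ 1 n (3 / 2) : EReal)) atTop ≤
      ((1 / 2 * Real.log (a ^ 2 + 2) : ℝ) : EReal) := by
    -- The split `3/2 = 1/2 + 1` gives the second coordinate exactly its noise variance.
    have h := limsup_le_of_le_add
      (fun n => hsub n (1 / 2) 1 (by norm_num) one_pos) hR₁ hR₂
    rwa [add_zero, show (1 / 2 + 1 : ℝ) = 3 / 2 by norm_num] at h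
  refine ⟨hR₁, hR₂, hlim, fun h => ?_⟩
  rw [HasSRD] at h
  rw [h.limsup_eq, EReal.coe_le_coe_iff] at hlim
  exact absurd hlim (log_lt_claimedForm_diag ha).not_ge
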